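/- Let $\mathcal P=(\mathbf x,\mathbf r)$ be a group presentation, where $\mathbf r$ is a set of elements of the free group $F$ on $\mathbf x$. Let $Y\cup Y^{-1}$ be the set of formal symbols $({}^{u}r)^{\varepsilon}$ with $u\in F$, $r\in\mathbf r$, $\varepsilon=\pm1$. For $a=({}^{u}r)^{\varepsilon}$ put $\theta(a)=ur^{\varepsilon}u^{-1}\in F$, $a^{-1}=({}^{u}r)^{-\varepsilon}$, and ${}^{w}a=({}^{wu}r)^{\varepsilon}$ for $w\in F$. A $Y$-sequence is a finite, possibly empty, sequence $(a_1,\dots,a_n)$ of such symbols; it is an identity $Y$-sequence if $\theta(a_1)\cdots\theta(a_n)=1$ in $F$. Peiffer equivalence is the equivalence relation on $Y$-sequences generated by replacing an adjacent pair $(a,b)$ by $({}^{\theta(a)}b,a)$ or by $(b,{}^{\theta(b)^{-1}}a)$, and by deleting an adjacent pair $(a,a^{-1})$. The presentation $\mathcal P$ is called aspherical if every identity $Y$-sequence is Peiffer equivalent to the empty sequence. Let $\Upsilon$ be the monoid presented by the generators $Y\cup Y^{-1}$ and the relations $ab=({}^{\theta(a)}b)\,a$ for $a,b\in Y\cup Y^{-1}$,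 let $\sigma$ be the canonical homomorphism from the free monoid on $Y\cup Y^{-1}$ (the monoid of $Y$-sequences) onto $\Upsilon$, and let $\mathfrak U$ be the submonoid of $\Upsilon$ generated by all $\sigma(a)\sigma(a^{-1})$ with $a\in Y\cup Y^{-1}$. For a submonoid $U$ of a monoid $S$, the weak dominion $\mathrm{WDom}_S(U)$ is the set of all $d\in S$ such that $g(d)=h(d)$ for every group $K$ and all monoid homomorphisms $g,h:S\to K$ that coincide on $U$. Let $r_0\in\mathbf r$ and $\mathcal P_1=(\mathbf x,\mathbf r\setminus\{r_0\})$. Write $Y_1$, $\Upsilon_1$, $\sigma_1$, $\mathfrak U_1$ for the objects above formed from $\mathcal P_1$, and let $f:\Upsilon_1\to\Upsilon$ be the homomorphism induced by $\sigma_1(a)\mapsto\sigma(a)$. **Theorem.** If $\mathcal P$ is aspherical, then for every identity $Y_1$-sequence $d_1$, $$f(\sigma_1(d_1))\in \mathrm{WDom}_{\Upsilon}\bigl(f(\mathfrak U_1)\bigr).$$ -/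

import Mathlib

universe u v

namespace Whitehead

/-! ### Weak dominions -/

/-- The weak dominion of a submonoid `U` of a monoid `S`: the elements `d` of `S` on which any two
monoid homomorphisms from `S` to a group agree as soon as they agree on `U`. -/
def weakDominion {S : Type u} [Monoid S] (U : Submonoid S) : Set S :=
  {d | ∀ (G : Type v) [Group G] (f g : S →* G), (∀ s ∈ U, f s = g s) → f d = g d}

/-! ### Y-sequences of a group presentation

A group presentation is given by a type `X` of generators and a set `R` of elements of the free
group on `X` (the relators). -/

/-- The formal symbols `(ᵘr)^ε` with `u` in the free group, `r` a relator and `ε = ±1`,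
that is, the elements of `Y ∪ Y⁻¹`. -/
@[ext]
structure YLetter {X : Type u} (R : Set (FreeGroup X)) where
  /-- the conjugating element `u` -/
  conj : FreeGroup X
  /-- the relator `r` -/
  rel : R
  /-- the sign `ε` -/
  sign : ℤˣ

namespace YLetter

variable {X : Type u} {R : Set (FreeGroup X)}

/-- The value `u r^ε u⁻¹` of the symbol `(ᵘr)^ε` in the free group. -/
def theta (a : YLetter R) : FreeGroup X :=
  a.conj * (a.rel : FreeGroup X) ^ (a.sign : ℤ) * a.conj⁻¹

/-- The formal inverse `(ᵘr)^(-ε)` of `(ᵘr)^ε`. -/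
def inv (a : YLetter R) : YLetter R := ⟨a.conj, a.rel, -a.sign⟩

/-- The left action of the free group: `w` sends `(ᵘr)^ε` to `(ʷᵘr)^ε`. -/
def act (w : FreeGroup X) (a : YLetter R) : YLetter R := ⟨w * a.conj, a.rel, a.sign⟩

/-- A symbol over a set of relators is also a symbol over any larger set of relators. -/
def incl {R₁ : Set (FreeGroup X)} (h : R₁ ⊆ R) (a : YLetter R₁) : YLetter R :=
  ⟨a.conj, Set.inclusion h a.rel, a.sign⟩

end YLetter

section Presentation

variable {X : Type u} (R : Set (FreeGroup X))

/-- The `Y`-sequences: finite, possibly empty sequences of symbols `(ᵘr)^ε`, as the free monoid on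
`Y ∪ Y⁻¹`. -/
abbrev YSeq := FreeMonoid (YLetter R)

/-- A `Y`-sequence `((ᵘ¹r₁)^ε₁, …, (ᵘⁿrₙ)^εₙ)` is an identity `Y`-sequence if the product of the
`uᵢ rᵢ^εᵢ uᵢ⁻¹` is trivial in the free group. -/
def IsIdentityYSeq (d : YSeq R) : Prop := FreeMonoid.lift YLetter.theta d = 1

/-- The elementary Peiffer operations on `Y`-sequences: the two exchanges and the deletion. -/
inductive PeifferStep : YSeq R → YSeq R → Prop
  | exchange_left (p q : YSeq R) (a b : YLetter R) :
      PeifferStep (p * (FreeMonoid.of a * FreeMonoid.of b) * q)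
        (p * (FreeMonoid.of (b.act a.theta) * FreeMonoid.of a) * q)
  | exchange_right (p q : YSeq R) (a b : YLetter R) :
      PeifferStep (p * (FreeMonoid.of a * FreeMonoid.of b) * q)
        (p * (FreeMonoid.of b * FreeMonoid.of (a.act b.theta⁻¹)) * q)
  | deletion (p q : YSeq R) (a : YLetter R) :
      PeifferStep (p * (FreeMonoid.of a * FreeMonoid.of a.inv) * q) (p * q)

/-- Peiffer equivalence: the equivalence relation generated by exchanges, deletions and (through
symmetry) insertions. -/
def PeifferEquiv : YSeq R → YSeq R → Prop := Relation.EqvGen (PeifferStep R)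

/-- A presentation is aspherical if every identity `Y`-sequence is Peiffer equivalent to the empty
sequence. -/
def IsAspherical : Prop := ∀ d : YSeq R, IsIdentityYSeq R d → PeifferEquiv R d 1

/-! ### The monoid of `Y`-sequences up to exchange -/

/-- The defining relations `ab = (^{θ(a)}b) a`, for `a, b ∈ Y ∪ Y⁻¹`. -/
inductive UpsilonRel : FreeMonoid (YLetter R) → FreeMonoid (YLetter R) → Prop
  | mk (a b : YLetter R) :
      UpsilonRel (FreeMonoid.of a * FreeMonoid.of b)
        (FreeMonoid.of (b.act a.theta) * FreeMonoid.of a)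

/-- The monoid `Υ` with generators `Y ∪ Y⁻¹` and relations `ab = (^{θ(a)}b) a`. -/
abbrev Upsilon := PresentedMonoid (UpsilonRel R)

/-- The canonical homomorphism `σ` from the free monoid on `Y ∪ Y⁻¹` to `Υ`. -/
abbrev sigma : YSeq R →* Upsilon R := PresentedMonoid.mk (UpsilonRel R)

/-- The submonoid `𝔘` of `Υ` generated by the elements `σ(a)σ(a⁻¹)`, `a ∈ Y ∪ Y⁻¹`. -/
def frakU : Submonoid (Upsilon R) :=
  Submonoid.closure
    (Set.range fun a : YLetter R => sigma R (FreeMonoid.of a) * sigma R (FreeMonoid.of a.inv))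

end Presentation

/-- For `R₁ ⊆ R`, the homomorphism `f : Υ₁ → Υ` induced by `σ₁(a) ↦ σ(a)`. -/
def upsilonMap {X : Type u} {R₁ R : Set (FreeGroup X)} (h : R₁ ⊆ R) : Upsilon R₁ →* Upsilon R :=
  PresentedMonoid.lift (fun a => sigma R (FreeMonoid.of (a.incl h))) (by
    rintro _ _ ⟨a, b⟩
    simp only [map_mul, FreeMonoid.lift_eval_of]
    rw [← map_mul, ← map_mul]
    exact PresentedMonoid.mk_eq_mk_of_rel (UpsilonRel.mk (a.incl h) (b.incl h)))

end Whitehead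

/-! Two homomorphisms `g`, `h` to a group `G` that agree on `f(𝔘₁)` combine into one map to `G × G`.
Let `H` be the subgroup generated by the values `p a` of the symbols. The exchange relations make
each `p a * p a.inv` central in `H` and dependent only on the relator and on the class of `u` in the
group of the presentation.

By asphericity an identity sequence avoiding `r₀` reduces to the empty one, but pairs involving `r₀`
may be inserted and deleted on the way. Counting positive `r₀`-symbols in the group ring records
these pairs; the count is unchanged by exchanges, and dividing by the central element it determines
cancels their effect. The count is zero at both ends, so the value in `H` is a product of elements
`(p a * p a.inv)^±1` with `a` not involving `r₀`. On these `g` and `h` agree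
(`IsAspherical.lift_mem_closure`). -/

namespace Whitehead

namespace YLetter

variable {X : Type u} {R : Set (FreeGroup X)}

@[simp]
theorem inv_inv (a : YLetter R) : a.inv.inv = a := by
  ext <;> simp [inv]

@[simp]
theorem theta_inv (a : YLetter R) : a.inv.theta = a.theta⁻¹ := by
  simp [inv, theta, mul_assoc]

@[simp]
theorem act_act (v w : FreeGroup X) (a : YLetter R) : (a.act w).act v = a.act (v * w) := by
  simp [act, mul_assoc]

@[simp]
theorem act_one (a : YLetter R) : a.act 1 = a := by
  simp [act]

theorem inv_act (w : FreeGroup X) (a : YLetter R) : (a.act w).inv = a.inv.act w := rfl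

theorem theta_mem_normalClosure (a : YLetter R) : a.theta ∈ Subgroup.normalClosure R :=
  Subgroup.normalClosure_normal.conj_mem _
    (Subgroup.zpow_mem _ (Subgroup.subset_normalClosure a.rel.2) _) _

theorem theta_incl {R₁ : Set (FreeGroup X)} (h : R₁ ⊆ R) (a : YLetter R₁) :
    (a.incl h).theta = a.theta := rfl

end YLetter

/-! ### Enlarging the set of relators -/

section Sequences

variable {X : Type u} {R₁ R : Set (FreeGroup X)}

theorem IsIdentityYSeq.map_incl (h : R₁ ⊆ R) {d : YSeq R₁} (hd : IsIdentityYSeq R₁ d) :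
    IsIdentityYSeq R (FreeMonoid.map (YLetter.incl h) d) := by
  have key : (FreeMonoid.lift YLetter.theta).comp (FreeMonoid.map (YLetter.incl h)) =
      FreeMonoid.lift (YLetter.theta (R := R₁)) := by
    ext a
    simp [YLetter.theta_incl]
  exact (DFunLike.congr_fun key d).trans hd

theorem upsilonMap_sigma (h : R₁ ⊆ R) (d : YSeq R₁) :
    upsilonMap h (sigma R₁ d) = sigma R (FreeMonoid.map (YLetter.incl h) d) := by
  have key : (upsilonMap h).comp (sigma R₁) =
      (sigma R).comp (FreeMonoid.map (YLetter.incl h)) := by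
    ext a
    rfl
  exact DFunLike.congr_fun key d

end Sequences

/-! ### Representations of the exchange relations in a group -/

noncomputable section Exchange

open scoped IsMulCommutative

variable {X : Type u} {R : Set (FreeGroup X)} {K : Type v} [Group K] {p : YLetter R → K}

theorem map_act_theta (hp : ∀ a b, p a * p b = p (b.act a.theta) * p a) (a b : YLetter R) :
    p (b.act a.theta) = p a * p b * (p a)⁻¹ := by
  rw [hp, mul_inv_cancel_right]

/-- Moving `p b` leftwards past `p a.inv` and then `p a` acts on `b` by `θ(a)θ(a)⁻¹ = 1`. -/
theorem map_mul_map_inv_comm (hp : ∀ a b, p a * p b = p (b.act a.theta) * p a)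
    (a b : YLetter R) : p b * (p a * p a.inv) = p a * p a.inv * p b := by
  rw [mul_assoc (p a) (p a.inv) (p b), hp a.inv b, ← mul_assoc (p a), hp a (b.act a.inv.theta),
    mul_assoc]
  simp

theorem map_mul_map_inv_mem_center (hp : ∀ a b, p a * p b = p (b.act a.theta) * p a)
    (hgen : Subgroup.closure (Set.range p) = ⊤) (a : YLetter R) :
    p a * p a.inv ∈ Subgroup.center K := by
  rw [Subgroup.mem_center_iff]
  intro k
  have hk : k ∈ Subgroup.closure (Set.range p) := hgen ▸ Subgroup.mem_top k
  have hle : Subgroup.closure (Set.range p) ≤ Subgroup.centralizer {p a * p a.inv} := by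
    rw [Subgroup.closure_le]
    rintro _ ⟨b, rfl⟩
    rw [SetLike.mem_coe, Subgroup.mem_centralizer_singleton_iff]
    exact (map_mul_map_inv_comm hp a b)
  exact (Subgroup.mem_centralizer_singleton_iff.1 (hle hk))

theorem map_inv_mul_map (hp : ∀ a b, p a * p b = p (b.act a.theta) * p a) (a : YLetter R) :
    p a.inv * p a = p a * p a.inv :=
  mul_left_cancel (a := p a) (by rw [map_mul_map_inv_comm hp a a, mul_assoc])

/-- A conjugate `c r c⁻¹` is `θ` of a symbol `b`, so it acts on values as conjugation by `p b`,
which fixes `p a * p a.inv`. -/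
theorem map_mul_map_inv_act (hp : ∀ a b, p a * p b = p (b.act a.theta) * p a)
    {w : FreeGroup X} (hw : w ∈ Subgroup.normalClosure R) (a : YLetter R) :
    p (a.act w) * p (a.act w).inv = p a * p a.inv := by
  induction hw using Subgroup.closure_induction generalizing a with
  | mem w hw =>
    obtain ⟨r, hr, hrw⟩ := Group.mem_conjugatesOfSet_iff.1 hw
    obtain ⟨c, rfl⟩ := isConj_iff.1 hrw
    have hb : (⟨c, ⟨r, hr⟩, 1⟩ : YLetter R).theta = c * r * c⁻¹ := by simp [YLetter.theta]
    rw [← hb, YLetter.inv_act, map_act_theta hp, map_act_theta hp]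
    rw [conj_mul, map_mul_map_inv_comm hp, mul_inv_cancel_right]
  | one => simp
  | mul v w _ _ hv hw => rw [← YLetter.act_act, hv, hw]
  | inv w _ hw => rw [← hw (a.act w⁻¹)]; simp

/-- The central element `p(a) p(a⁻¹)` attached to a symbol. -/
def centralElement (hp : ∀ a b, p a * p b = p (b.act a.theta) * p a)
    (hgen : Subgroup.closure (Set.range p) = ⊤) (a : YLetter R) : Subgroup.center K :=
  ⟨p a * p a.inv, map_mul_map_inv_mem_center hp hgen a⟩

variable (R) in
/-- The group defined by the presentation. -/
abbrev RelGroup := FreeGroup X ⧸ Subgroup.normalClosure R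

open Classical in
/-- The coefficient at the positive symbols with relator `r`, with values in the integral group
ring (as an abelian group) of the group of the presentation. -/
def coefficient (r : R) : YSeq R →* Multiplicative (FreeAbelianGroup (RelGroup R)) :=
  FreeMonoid.lift fun a => Multiplicative.ofAdd
    (if a.rel = r ∧ a.sign = 1 then FreeAbelianGroup.of (a.conj : RelGroup R) else 0)

theorem coefficient_of_act (r : R) {w : FreeGroup X} (hw : w ∈ Subgroup.normalClosure R)
    (a : YLetter R) :
    coefficient r (FreeMonoid.of (a.act w)) = coefficient r (FreeMonoid.of a) := by
  have : ((w * a.conj : FreeGroup X) : RelGroup R) = a.conj := by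
    rw [QuotientGroup.mk_mul, (QuotientGroup.eq_one_iff w).2 hw, one_mul]
  simp [coefficient, YLetter.act, this]

theorem coefficient_eq_one (r : R) {a : YLetter R} (ha : a.rel ≠ r) :
    coefficient r (FreeMonoid.of a) = 1 := by
  simp [coefficient, ha]

/-- Exactly one of `a`, `a.inv` is positive, so counting positive symbols counts each inverse pair
once, whatever its order. -/
theorem coefficient_of_mul_of_inv (r : R) {a : YLetter R} (ha : a.rel = r) :
    coefficient r (FreeMonoid.of a) * coefficient r (FreeMonoid.of a.inv) =
      Multiplicative.ofAdd (FreeAbelianGroup.of (a.conj : RelGroup R)) := by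
  rcases Int.units_eq_one_or a.sign with h | h <;>
    simp [coefficient, YLetter.inv, ha, h, show (-1 : ℤˣ) ≠ 1 by decide]

/-- The homomorphism from the group ring to the center sending the class of `u` to
`p(ᵘr) p((ᵘr)⁻¹)`. -/
def realize (hp : ∀ a b, p a * p b = p (b.act a.theta) * p a)
    (hgen : Subgroup.closure (Set.range p) = ⊤) (r : R) :
    Multiplicative (FreeAbelianGroup (RelGroup R)) →* Subgroup.center K :=
  AddMonoidHom.toMultiplicativeLeft (FreeAbelianGroup.lift fun x =>
    Additive.ofMul (centralElement hp hgen ⟨x.out, r, 1⟩))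

theorem realize_of (hp : ∀ a b, p a * p b = p (b.act a.theta) * p a)
    (hgen : Subgroup.closure (Set.range p) = ⊤) (a : YLetter R) :
    realize hp hgen a.rel (Multiplicative.ofAdd (FreeAbelianGroup.of (a.conj : RelGroup R))) =
      centralElement hp hgen a := by
  obtain ⟨n, hn⟩ := QuotientGroup.mk_out_eq_mul (Subgroup.normalClosure R) a.conj
  have hact : (⟨(a.conj : RelGroup R).out, a.rel, 1⟩ : YLetter R) =
      (⟨a.conj, a.rel, 1⟩ : YLetter R).act (a.conj * (n : FreeGroup X) * a.conj⁻¹) := by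
    simp [YLetter.act, hn]
  have hmem : a.conj * (n : FreeGroup X) * a.conj⁻¹ ∈ Subgroup.normalClosure R :=
    Subgroup.normalClosure_normal.conj_mem _ n.2 _
  ext
  simp only [realize, AddMonoidHom.coe_toMultiplicativeLeft, Function.comp_apply, toAdd_ofAdd,
    FreeAbelianGroup.lift_apply_of, toMul_ofMul, centralElement]
  rw [hact, map_mul_map_inv_act hp hmem]
  -- The sign does not matter because `p a` and `p a.inv` commute.
  rcases Int.units_eq_one_or a.sign with h | h
  · rw [← h]
  · have : (⟨a.conj, a.rel, 1⟩ : YLetter R) = a.inv := by simp [YLetter.inv, h]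
    rw [this, YLetter.inv_inv, map_inv_mul_map hp]

/-- The value of a `Y`-sequence, corrected by the central element that its coefficient at `r`
determines. -/
def correctedValue (hp : ∀ a b, p a * p b = p (b.act a.theta) * p a)
    (hgen : Subgroup.closure (Set.range p) = ⊤) (r : R) : YSeq R → K :=
  fun d => FreeMonoid.lift p d * ((realize hp hgen r (coefficient r d) : Subgroup.center K) : K)⁻¹

/-- Exchanges change neither the value nor the coefficient. Deleting a pair with relator `r` changes
both, and the changes cancel; deleting any other pair changes only the value, by a generator of the
subgroup. -/
theorem PeifferStep.correctedValue_div_mem (hp : ∀ a b, p a * p b = p (b.act a.theta) * p a)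
    (hgen : Subgroup.closure (Set.range p) = ⊤) (r : R) {d d' : YSeq R}
    (h : PeifferStep R d d') :
    correctedValue hp hgen r d / correctedValue hp hgen r d' ∈
      Subgroup.closure {k | ∃ a : YLetter R, a.rel ≠ r ∧ p a * p a.inv = k} := by
  cases h with
  | exchange_left s t a b =>
    convert Subgroup.one_mem _
    rw [div_eq_one]
    simp only [correctedValue, map_mul, FreeMonoid.lift_eval_of, hp a b,
      coefficient_of_act r a.theta_mem_normalClosure]
    rw [mul_comm (realize hp hgen r (coefficient r (FreeMonoid.of a)))]
  | exchange_right s t a b =>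
    convert Subgroup.one_mem _
    rw [div_eq_one]
    -- A right exchange is a left exchange of the pair `(b, a.act b.theta⁻¹)` read backwards.
    simp only [correctedValue, map_mul, FreeMonoid.lift_eval_of, hp b (a.act b.theta⁻¹),
      coefficient_of_act r (inv_mem b.theta_mem_normalClosure), YLetter.act_act, mul_inv_cancel,
      YLetter.act_one]
    rw [mul_comm (realize hp hgen r (coefficient r (FreeMonoid.of a)))]
  | deletion s t a =>
    set c := centralElement hp hgen a with hc
    have hcoe : p a * p a.inv = c := rfl
    have hcomm (k : K) : k * c = c * k := Subgroup.mem_center_iff.1 c.2 k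
    by_cases ha : a.rel = r
    · convert Subgroup.one_mem _
      rw [div_eq_one]
      subst ha
      simp only [correctedValue, map_mul, FreeMonoid.lift_eval_of, hcoe]
      rw [← map_mul (realize hp hgen a.rel) (coefficient _ (FreeMonoid.of a)),
        coefficient_of_mul_of_inv _ rfl, realize_of, ← hc]
      simp only [Subgroup.coe_mul]
      rw [mul_assoc _ (c : K), mul_assoc _ (c : K), ← hcomm, ← hcomm]
      group
    · refine Subgroup.subset_closure ⟨a, ha, ?_⟩
      have ha' : a.inv.rel ≠ r := ha
      rw [eq_div_iff_mul_eq']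
      simp only [correctedValue, map_mul, FreeMonoid.lift_eval_of, hcoe, coefficient_eq_one r ha,
        coefficient_eq_one r ha', mul_one, hcomm]
      simp only [mul_assoc]

theorem PeifferEquiv.correctedValue_div_mem (hp : ∀ a b, p a * p b = p (b.act a.theta) * p a)
    (hgen : Subgroup.closure (Set.range p) = ⊤) (r : R) {d d' : YSeq R}
    (h : PeifferEquiv R d d') :
    correctedValue hp hgen r d / correctedValue hp hgen r d' ∈
      Subgroup.closure {k | ∃ a : YLetter R, a.rel ≠ r ∧ p a * p a.inv = k} := by
  induction h with
  | rel _ _ h => exact h.correctedValue_div_mem hp hgen r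
  | refl _ => simp
  | symm _ _ _ ih => simpa using inv_mem ih
  | trans _ _ _ _ _ ih₁ ih₂ => simpa using mul_mem ih₁ ih₂

/-- In an aspherical presentation, an identity `Y`-sequence that does not involve the relator `r`
takes its value in the subgroup generated by the `p(a) p(a⁻¹)` with `a` not involving `r`. -/
theorem IsAspherical.lift_mem_closure (hR : IsAspherical R)
    (hp : ∀ a b, p a * p b = p (b.act a.theta) * p a)
    (hgen : Subgroup.closure (Set.range p) = ⊤) (r : R) {d : YSeq R} (hd : IsIdentityYSeq R d)
    (hdr : coefficient r d = 1) :
    FreeMonoid.lift p d ∈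
      Subgroup.closure {k | ∃ a : YLetter R, a.rel ≠ r ∧ p a * p a.inv = k} := by
  simpa [correctedValue, hdr] using (hR d hd).correctedValue_div_mem hp hgen r

end Exchange

/-! ### Removing one relator -/

theorem coefficient_map_incl {X : Type u} {R : Set (FreeGroup X)} (r : R)
    (d : YSeq (R \ {(r : FreeGroup X)})) :
    coefficient r (FreeMonoid.map (YLetter.incl Set.sdiff_subset) d) = 1 := by
  have key : (coefficient r).comp (FreeMonoid.map (YLetter.incl Set.sdiff_subset)) =
      (1 : YSeq (R \ {(r : FreeGroup X)}) →* _) := by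
    ext a
    exact congrArg _ (coefficient_eq_one r fun h => a.rel.2.2 (congrArg Subtype.val h))
  exact DFunLike.congr_fun key d

end Whitehead

open Whitehead in
theorem mainTheorem5 {X : Type u} (R : Set (FreeGroup X)) (r₀ : FreeGroup X) (hr₀ : r₀ ∈ R)
    (hR : Whitehead.IsAspherical R)
    (d₁ : Whitehead.YSeq (R \ {r₀})) (hd₁ : Whitehead.IsIdentityYSeq (R \ {r₀}) d₁) :
    Whitehead.upsilonMap (R₁ := R \ {r₀}) (R := R) Set.sdiff_subset
        (Whitehead.sigma (R \ {r₀}) d₁) ∈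
      Whitehead.weakDominion.{u, v}
        ((Whitehead.frakU (R \ {r₀})).map
          (Whitehead.upsilonMap (R₁ := R \ {r₀}) (R := R) Set.sdiff_subset)) := by
  intro G _ g h hgh
  -- Centrality of `p a * p a.inv` needs the values of `p` to generate, so `G × G` is cut down to
  -- the subgroup they generate.
  let H : Subgroup (G × G) := Subgroup.closure
    (Set.range fun a : YLetter R => g.prod h (sigma R (FreeMonoid.of a)))
  let p : YLetter R → H := fun a =>
    ⟨g.prod h (sigma R (FreeMonoid.of a)), Subgroup.subset_closure ⟨a, rfl⟩⟩
  have hp (a b : YLetter R) : p a * p b = p (b.act a.theta) * p a := by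
    apply Subtype.ext
    simp only [p, Subgroup.coe_mul, ← map_mul]
    exact congrArg _ (PresentedMonoid.mk_eq_mk_of_rel (UpsilonRel.mk a b))
  have hgen : Subgroup.closure (Set.range p) = ⊤ := by
    refine Eq.trans ?_ (Subgroup.closure_closure_coe_preimage
      (k := Set.range fun a : YLetter R => g.prod h (sigma R (FreeMonoid.of a))))
    congr 1
    ext x
    simp only [Set.mem_range, Set.mem_preimage, p, Subtype.ext_iff]
  have hlift (d : YSeq R) : ((FreeMonoid.lift p d : H) : G × G) = g.prod h (sigma R d) := by
    have key : H.subtype.comp (FreeMonoid.lift p) = (g.prod h).comp (sigma R) := by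
      ext a <;> simp [p]
    exact DFunLike.congr_fun key d
  have hmem := hR.lift_mem_closure hp hgen ⟨r₀, hr₀⟩ (hd₁.map_incl Set.sdiff_subset)
    (coefficient_map_incl ⟨r₀, hr₀⟩ d₁)
  have hle : Subgroup.closure
      {k | ∃ a : YLetter R, a.rel ≠ ⟨r₀, hr₀⟩ ∧ p a * p a.inv = k} ≤
      ((MonoidHom.fst G G).comp H.subtype).eqLocus ((MonoidHom.snd G G).comp H.subtype) := by
    rw [Subgroup.closure_le]
    rintro _ ⟨a, ha, rfl⟩
    -- A symbol not involving `r₀` comes from the smaller presentation, so `p a * p a.inv` has equal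
    -- coordinates by the agreement on `f(𝔘₁)`.
    let a₁ : YLetter (R \ {r₀}) :=
      ⟨a.conj, ⟨a.rel, a.rel.2, fun h => ha (Subtype.ext h)⟩, a.sign⟩
    have := hgh _ (Submonoid.mem_map_of_mem _ (Submonoid.subset_closure ⟨a₁, rfl⟩))
    simp only [map_mul, upsilonMap_sigma] at this
    exact this
  have := hle hmem
  rw [upsilonMap_sigma]
  change (FreeMonoid.lift p _ : H).1.1 = (FreeMonoid.lift p _ : H).1.2 at this
  rwa [hlift] at this
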